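/- Let $\mathbb K$ be $\mathbb R$ or $\mathbb C$, and let $E$ and $F$ be infinite-dimensional Banach spaces over $\mathbb K$. Suppose that each $X\in\{E,F\}$ contains uniformly complemented copies of $\ell_2^n$ for all $n$, that is, there is a constant $C=C_X$ such that for every natural $n$ there are an $n$-dimensional subspace $X_n\subset X$ and a bounded linear projection $P_n\colon X\to X_n$ (so $P_nx=x$ for $x\in X_n$) with $\|P_n\|\le C$ and $d(X_n,\ell_2^n)\le C$. Here $\ell_2^n$ is $\mathbb K^n$ with the Euclidean norm and $d(Y,Z)=\inf\|T\|\,\|T^{-1}\|$, over all linear isomorphisms $T\colon Y\to Z$ with $T$ and $T^{-1}$ bounded, is the Banach--Mazur distance. Then $$\mathrm{Ext}^1(F,E)\neq 0.$$ Here $\mathrm{Ext}^1(F,E)$ is the set of congruence classes of extensions of Banach spaces, i.e. of short exact sequences $0\to E\xrightarrow{\,i\,}G\xrightarrow{\,\sigma\,}F\to 0$ with $G$ a Banach space over $\mathbb K$ and $i,\sigma$ bounded linear operators. Two such extensions, with middle spaces $G_1,G_2$ and operators $i_1,\sigma_1$ and $i_2,\sigma_2$, are congruent if there is an isomorphism of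 Banach spaces $h\colon G_1\to G_2$ (bounded, linear, with bounded inverse) such that $h i_1=i_2$ and $\sigma_2h=\sigma_1$. The zero element is the class of the trivial extension $0\to E\to E\oplus F\to F\to 0$. In other words, there is an extension of this form that is not congruent to the trivial one. -/

import Mathlib

open scoped ENNReal NNReal

universe u v w

namespace BanachExt

/-- An extension of Banach spaces over `𝕜`: a short exact sequence
`0 → E → G → F → 0` with `G` a Banach space and bounded linear maps. -/
structure Extension (𝕜 : Type w) [RCLike 𝕜]
    (F : Type v) [NormedAddCommGroup F] [NormedSpace 𝕜 F]
    (E : Type u) [NormedAddCommGroup E] [NormedSpace 𝕜 E] where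
  /-- the middle space -/
  G : Type (max u v)
  [normedAddCommGroup : NormedAddCommGroup G]
  [normedSpace : NormedSpace 𝕜 G]
  [completeSpace : CompleteSpace G]
  /-- the embedding of `E` -/
  i : E →L[𝕜] G
  /-- the quotient operator onto `F` -/
  σ : G →L[𝕜] F
  injective : Function.Injective i
  exact : Function.Exact i σ
  surjective : Function.Surjective σ

attribute [instance] Extension.normedAddCommGroup Extension.normedSpace Extension.completeSpace

section

variable (𝕜 : Type w) [RCLike 𝕜]
  (F : Type v) [NormedAddCommGroup F] [NormedSpace 𝕜 F]
  (E : Type u) [NormedAddCommGroup E] [NormedSpace 𝕜 E]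

/-- Two extensions are congruent if there is an isomorphism of the middle spaces that
commutes with the embeddings of `E` and with the quotient operators onto `F`. -/
def Congruent (X Y : Extension 𝕜 F E) : Prop :=
  ∃ h : X.G ≃L[𝕜] Y.G, (∀ e : E, h (X.i e) = Y.i e) ∧ ∀ g : X.G, Y.σ (h g) = X.σ g

theorem congruent_equivalence : Equivalence (Congruent 𝕜 F E) where
  refl X := ⟨ContinuousLinearEquiv.refl 𝕜 X.G, fun _ => rfl, fun _ => rfl⟩
  symm := by
    rintro X Y ⟨h, h1, h2⟩
    refine ⟨h.symm, fun e => ?_, fun g => ?_⟩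
    · rw [← h1, h.symm_apply_apply]
    · rw [← h2, h.apply_symm_apply]
  trans := by
    rintro X Y Z ⟨h, h1, h2⟩ ⟨k, k1, k2⟩
    refine ⟨h.trans k, fun e => ?_, fun g => ?_⟩
    · simp [h1, k1]
    · simp [h2, k2]

/-- Congruence as an equivalence relation on extensions. -/
def extensionSetoid : Setoid (Extension 𝕜 F E) where
  r := Congruent 𝕜 F E
  iseqv := congruent_equivalence 𝕜 F E

/-- `Ext¹(F, E)`: the congruence classes of extensions `0 → E → G → F → 0`. -/
def Ext1 : Type (max (u + 1) (v + 1) w) :=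
  Quotient (extensionSetoid 𝕜 F E)

/-- The class in `Ext¹(F, E)` of an extension. -/
def Ext1.mk (X : Extension 𝕜 F E) : Ext1 𝕜 F E :=
  Quotient.mk (extensionSetoid 𝕜 F E) X

/-- The trivial extension `0 → E → E ⊕ F → F → 0`. -/
abbrev trivialExtension [CompleteSpace E] [CompleteSpace F] : Extension 𝕜 F E where
  G := E × F
  i := ContinuousLinearMap.inl 𝕜 E F
  σ := ContinuousLinearMap.snd 𝕜 E F
  injective := LinearMap.inl_injective
  exact := by
    rintro ⟨e, f⟩
    constructor
    · intro h
      exact ⟨e, Prod.ext rfl (Eq.symm h)⟩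
    · rintro ⟨e', h⟩
      exact (congrArg Prod.snd h).symm
  surjective := Prod.snd_surjective

/-- The zero element of `Ext¹(F, E)` is the class of the trivial extension. -/
instance instZeroExt1 [CompleteSpace E] [CompleteSpace F] : Zero (Ext1 𝕜 F E) :=
  ⟨Ext1.mk 𝕜 F E (trivialExtension 𝕜 F E)⟩

end

/-- The (multiplicative) Banach–Mazur distance `inf ‖T‖ ‖T⁻¹‖` over all isomorphisms
`T : X → Y`, equal to `∞` if there are none. -/
noncomputable def banachMazurDist (𝕜 : Type w) [RCLike 𝕜]
    (X : Type u) [NormedAddCommGroup X] [NormedSpace 𝕜 X]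
    (Y : Type v) [NormedAddCommGroup Y] [NormedSpace 𝕜 Y] : ℝ≥0∞ :=
  ⨅ T : X ≃L[𝕜] Y, ‖(T : X →L[𝕜] Y)‖ₑ * ‖(T.symm : Y →L[𝕜] X)‖ₑ

/-- `E` contains uniformly complemented copies of `ℓ_p^n` for all `n`. -/
def ContainsUniformlyComplementedLp (𝕜 : Type w) [RCLike 𝕜] (p : ℝ≥0∞) [Fact (1 ≤ p)]
    (E : Type u) [NormedAddCommGroup E] [NormedSpace 𝕜 E] : Prop :=
  ∃ C : ℝ≥0, ∀ n : ℕ, ∃ (En : Submodule 𝕜 E) (P : E →L[𝕜] En),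
    Module.rank 𝕜 En = n ∧ (∀ x : En, P (x : E) = x) ∧ ‖P‖ ≤ C ∧
      banachMazurDist 𝕜 En (PiLp p (fun _ : Fin n => 𝕜)) ≤ C

end BanachExt

open scoped lp

/-! ### Scalar estimates for `z ↦ z log |z|` -/

namespace Real

/-! The obstruction is the Kalton–Peck map `y ↦ (y i log |y i|)` on `ℓ₂ⁿ`. It is almost linear with
a constant independent of `n` (`norm_tsum_smul_kaltonPeck_le`), yet its distance on the ball to
every linear map grows like `log n` (`mul_log_le_of_norm_kaltonPeck_sub_le`).

Suppose every extension splits, and let `q` map `ℓ¹` of the unit ball of `F` onto `F`. By a pushout,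
operators from `ker q` to `E` extend to `ℓ¹`, and by the open mapping theorem they do so with one
bound `M`. The complemented copies in `F` and `E` transport the Kalton–Peck map to an operator `S`
on `ℓ¹` whose restriction to `ker q` has norm at most `2`. Extending this restriction gives `R`,
bounded uniformly in `n`. Since `S - R` vanishes on `ker q`, it induces a linear map on `F`, which
lies within `‖R‖` of the Kalton–Peck map. For large `n` this is impossible. -/

theorem mul_abs_log_sub_log_le {r t : ℝ} (hr : 0 < r) (ht : 0 ≤ t) :
    |log t - log r| * t ≤ r + t ^ 2 / r := by
  rcases ht.eq_or_lt with rfl | ht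
  · simp [hr.le]
  have h1 : log t - log r ≤ t / r := by
    rw [← log_div ht.ne' hr.ne']
    linarith [log_le_sub_one_of_pos (div_pos ht hr)]
  have h2 : log r - log t ≤ r / t := by
    rw [← log_div hr.ne' ht.ne']
    linarith [log_le_sub_one_of_pos (div_pos hr ht)]
  have h3 : |log t - log r| ≤ r / t + t / r := by
    rw [abs_le]
    constructor <;> linarith [div_pos ht hr, div_pos hr ht]
  calc |log t - log r| * t ≤ (r / t + t / r) * t := by gcongr
    _ = r + t ^ 2 / r := by field_simp

end Real

theorem RCLike.norm_log_norm_mul_self_le_one {𝕜 : Type*} [RCLike 𝕜] {z : 𝕜} (hz : ‖z‖ ≤ 1) :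
    ‖(Real.log ‖z‖ : 𝕜) * z‖ ≤ 1 := by
  rcases (norm_nonneg z).eq_or_lt with h | h
  · simp [← h]
  · rw [norm_mul, RCLike.norm_ofReal, ← abs_norm z, ← abs_mul, abs_norm]
    exact (Real.abs_log_mul_self_lt _ h hz).le

/-- The scalar form of the Kalton–Peck estimate: `z ↦ z log |z|` is almost linear in mean. -/
theorem norm_tsum_mul_log_norm_sq_le {𝕜 I : Type*} [RCLike 𝕜] {a y : I → 𝕜}
    (ha : Summable fun k => ‖a k‖) (hy : ∀ k, ‖y k‖ ≤ 1) (h0 : ∑' k, a k * y k = 0) :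
    ‖∑' k, a k * ((Real.log ‖y k‖ : 𝕜) * y k)‖ ^ 2 ≤
      4 * (∑' k, ‖a k‖) * ∑' k, ‖a k‖ * ‖y k‖ ^ 2 := by
  have hle : ∀ k, ‖a k‖ * ‖y k‖ ^ 2 ≤ ‖a k‖ := fun k =>
    mul_le_of_le_one_right (norm_nonneg _) (pow_le_one₀ (norm_nonneg _) (hy k))
  have hR : Summable fun k => ‖a k‖ * ‖y k‖ ^ 2 :=
    ha.of_nonneg_of_le (fun k => by positivity) hle
  have hay : Summable fun k => a k * y k := by
    refine Summable.of_norm_bounded ha fun k => ?_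
    rw [norm_mul]
    exact mul_le_of_le_one_right (norm_nonneg _) (hy k)
  have haw : Summable fun k => a k * ((Real.log ‖y k‖ : 𝕜) * y k) := by
    refine Summable.of_norm_bounded ha fun k => ?_
    rw [norm_mul]
    exact mul_le_of_le_one_right (norm_nonneg _) (RCLike.norm_log_norm_mul_self_le_one (hy k))
  set N := ∑' k, ‖a k‖ with hN
  set R := ∑' k, ‖a k‖ * ‖y k‖ ^ 2 with hRdef
  have hR0 : 0 ≤ R := tsum_nonneg fun k => by positivity
  have hRN : R ≤ N := hR.tsum_le_tsum hle ha
  -- For `R = 0` the radius `r` chosen below would be zero; here all terms vanish.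
  rcases hR0.eq_or_lt with h | hRpos
  · have hz : ∀ k, ‖a k‖ * ‖y k‖ ^ 2 = 0 := by
      have hsum : HasSum (fun k => ‖a k‖ * ‖y k‖ ^ 2) 0 := by
        rw [h]
        exact hR.hasSum
      exact congrFun ((hasSum_zero_iff_of_nonneg fun k => by positivity).1 hsum)
    have : ∀ k, a k * ((Real.log ‖y k‖ : 𝕜) * y k) = 0 := by
      intro k
      rcases mul_eq_zero.1 (hz k) with h | h
      · simp [norm_eq_zero.1 h]
      · simp [norm_eq_zero.1 (pow_eq_zero_iff two_ne_zero |>.1 h)]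
    simp only [this, tsum_zero, norm_zero]
    rw [← h]; simp
  have hNpos : 0 < N := hRpos.trans_le hRN
  -- This value minimises the bound `N * r + R / r`.
  set r := √(R / N) with hr
  have hrpos : 0 < r := Real.sqrt_pos.2 (div_pos hRpos hNpos)
  have hr2 : r ^ 2 = R / N := Real.sq_sqrt (div_pos hRpos hNpos).le
  -- As `∑ a k * y k = 0`, replacing `log |y k|` by `log (|y k| / r)` leaves the sum unchanged.
  have heq : ∑' k, a k * ((Real.log ‖y k‖ : 𝕜) * y k) =
      ∑' k, a k * (((Real.log ‖y k‖ - Real.log r : ℝ) : 𝕜) * y k) := by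
    have : ∑' k, (Real.log r : 𝕜) * (a k * y k) = 0 := by rw [tsum_mul_left, h0, mul_zero]
    rw [← sub_zero (∑' k, a k * ((Real.log ‖y k‖ : 𝕜) * y k)), ← this,
      ← haw.tsum_sub (hay.mul_left _)]
    refine tsum_congr fun k => ?_
    push_cast
    ring
  have hb : HasSum (fun k => ‖a k‖ * (r + ‖y k‖ ^ 2 / r)) (N * r + R / r) := by
    have := (ha.hasSum.mul_right r).add (hR.hasSum.div_const r)
    exact this.congr_fun fun k => by ring
  have hbound : ‖∑' k, a k * ((Real.log ‖y k‖ : 𝕜) * y k)‖ ≤ N * r + R / r := by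
    rw [heq]
    refine tsum_of_norm_bounded hb fun k => ?_
    rw [norm_mul, norm_mul, RCLike.norm_ofReal]
    gcongr
    exact Real.mul_abs_log_sub_log_le hrpos (norm_nonneg _)
  have hRr : R / r = N * r := by
    rw [div_eq_iff hrpos.ne', mul_assoc, ← sq, hr2]
    field_simp
  calc _ ≤ (N * r + R / r) ^ 2 := by gcongr
    _ = 4 * N * (N * r ^ 2) := by rw [hRr]; ring
    _ = 4 * N * R := by rw [hr2]; field_simp

/-! ### The Kalton–Peck map and operators on `ℓ¹` -/

/-- The unnormalised Kalton–Peck map on `ℓ₂ⁿ`. -/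
noncomputable def kaltonPeck {𝕜 : Type*} [RCLike 𝕜] {n : ℕ} (y : EuclideanSpace 𝕜 (Fin n)) :
    EuclideanSpace 𝕜 (Fin n) :=
  WithLp.toLp 2 fun i => (Real.log ‖y i‖ : 𝕜) * y i

@[simp]
theorem kaltonPeck_apply {𝕜 : Type*} [RCLike 𝕜] {n : ℕ} (y : EuclideanSpace 𝕜 (Fin n))
    (i : Fin n) : kaltonPeck y i = (Real.log ‖y i‖ : 𝕜) * y i := rfl

/-- This crude bound, which depends on `n`, only serves convergence and continuity; it does not
enter the final estimate. -/
theorem norm_kaltonPeck_le {𝕜 : Type*} [RCLike 𝕜] {n : ℕ} {y : EuclideanSpace 𝕜 (Fin n)}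
    (hy : ‖y‖ ≤ 1) : ‖kaltonPeck y‖ ≤ √n := by
  rw [EuclideanSpace.norm_eq]
  refine Real.sqrt_le_sqrt ?_
  calc ∑ i, ‖kaltonPeck y i‖ ^ 2 ≤ ∑ _i : Fin n, (1 : ℝ) := by
        refine Finset.sum_le_sum fun i _ => pow_le_one₀ (norm_nonneg _) ?_
        exact RCLike.norm_log_norm_mul_self_le_one ((PiLp.norm_apply_le y i).trans hy)
    _ = n := by simp

section LiftOne

variable {𝕜 : Type*} [RCLike 𝕜] {I : Type*} {Y : Type*} [NormedAddCommGroup Y] [NormedSpace 𝕜 Y]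
  [CompleteSpace Y]

theorem lp.summable_norm_one (a : ℓ¹(I, 𝕜)) : Summable fun k => ‖a k‖ := by
  simpa using (lp.memℓp a).summable (by simp)

theorem lp.norm_eq_tsum_one (a : ℓ¹(I, 𝕜)) : ‖a‖ = ∑' k, ‖a k‖ := by
  simpa using lp.norm_eq_tsum_rpow (by simp) a

theorem lp.summable_smul_of_bounded {u : I → Y} {C : ℝ} (hu : ∀ k, ‖u k‖ ≤ C) (a : ℓ¹(I, 𝕜)) :
    Summable fun k => a k • u k := by
  refine Summable.of_norm_bounded ((lp.summable_norm_one a).mul_right C) fun k => ?_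
  rw [norm_smul]
  gcongr
  exact hu k

/-- The operator on `ℓ¹(I)` that sends the unit vectors to a given bounded family. -/
noncomputable def lp.liftOne (𝕜 : Type*) [RCLike 𝕜] [NormedSpace 𝕜 Y] (u : I → Y) (C : ℝ)
    (hu : ∀ k, ‖u k‖ ≤ C) : ℓ¹(I, 𝕜) →L[𝕜] Y :=
  LinearMap.mkContinuous
    { toFun := fun a => ∑' k, a k • u k
      map_add' := fun a b => by
        rw [← (lp.summable_smul_of_bounded hu a).tsum_add (lp.summable_smul_of_bounded hu b)]
        simp [add_smul]
      map_smul' := fun c a => by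
        rw [RingHom.id_apply, ← (lp.summable_smul_of_bounded hu a).tsum_const_smul]
        simp [mul_smul] } C
    (fun a => by
      rw [mul_comm, lp.norm_eq_tsum_one]
      refine tsum_of_norm_bounded ((lp.summable_norm_one a).hasSum.mul_right C) fun k => ?_
      rw [norm_smul]
      gcongr
      exact hu k)

theorem lp.liftOne_apply (u : I → Y) (C : ℝ) (hu : ∀ k, ‖u k‖ ≤ C) (a : ℓ¹(I, 𝕜)) :
    lp.liftOne 𝕜 u C hu a = ∑' k, a k • u k := rfl

theorem lp.liftOne_single [DecidableEq I] (u : I → Y) (C : ℝ) (hu : ∀ k, ‖u k‖ ≤ C) (k : I) :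
    lp.liftOne 𝕜 u C hu (lp.single 1 k 1) = u k := by
  rw [lp.liftOne_apply, tsum_eq_single k]
  · simp
  · intro j hj
    simp [hj]

end LiftOne

/-- The Kalton–Peck estimate: the map `kaltonPeck` is `0`-linear on the unit ball. -/
theorem norm_tsum_smul_kaltonPeck_le {𝕜 I : Type*} [RCLike 𝕜] {n : ℕ}
    {u : I → EuclideanSpace 𝕜 (Fin n)} (hu : ∀ k, ‖u k‖ ≤ 1) (a : ℓ¹(I, 𝕜))
    (h0 : ∑' k, a k • u k = 0) :
    ‖∑' k, a k • kaltonPeck (u k)‖ ≤ 2 * ‖a‖ := by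
  have ha := lp.summable_norm_one a
  have hcoord : ∀ (v : I → EuclideanSpace 𝕜 (Fin n)) (C : ℝ), (∀ k, ‖v k‖ ≤ C) → ∀ i,
      (∑' k, a k • v k) i = ∑' k, a k * v k i := by
    intro v C hv i
    exact (EuclideanSpace.proj (𝕜 := 𝕜) i).map_tsum (lp.summable_smul_of_bounded hv a)
  have hui : ∀ i k, ‖u k i‖ ≤ 1 := fun i k => (PiLp.norm_apply_le (u k) i).trans (hu k)
  have hsumm : ∀ i, Summable fun k => ‖a k‖ * ‖u k i‖ ^ 2 := fun i =>
    ha.of_nonneg_of_le (fun k => by positivity) fun k =>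
      mul_le_of_le_one_right (norm_nonneg _) (pow_le_one₀ (norm_nonneg _) (hui i k))
  rw [← abs_of_nonneg (norm_nonneg (∑' k, a k • kaltonPeck (u k))),
    ← abs_of_nonneg (by positivity : 0 ≤ 2 * ‖a‖), ← sq_le_sq, EuclideanSpace.norm_sq_eq,
    lp.norm_eq_tsum_one]
  calc ∑ i, ‖(∑' k, a k • kaltonPeck (u k)) i‖ ^ 2
      ≤ ∑ i, 4 * (∑' k, ‖a k‖) * ∑' k, ‖a k‖ * ‖u k i‖ ^ 2 := by
        refine Finset.sum_le_sum fun i _ => ?_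
        rw [hcoord _ _ (fun k => norm_kaltonPeck_le (hu k)) i]
        refine norm_tsum_mul_log_norm_sq_le ha (hui i) ?_
        rw [← hcoord u 1 hu i, h0]
        rfl
    -- The dimension disappears here: the squared coordinates add up to `‖u k‖ ^ 2`.
    _ = 4 * (∑' k, ‖a k‖) * ∑' k, ‖a k‖ * ‖u k‖ ^ 2 := by
        rw [← Finset.mul_sum, ← Summable.tsum_finsetSum fun i _ => hsumm i]
        simp_rw [EuclideanSpace.norm_sq_eq, Finset.mul_sum]
    _ ≤ 4 * (∑' k, ‖a k‖) * ∑' k, ‖a k‖ := by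
        have hle : ∀ k, ‖a k‖ * ‖u k‖ ^ 2 ≤ ‖a k‖ := fun k =>
          mul_le_of_le_one_right (norm_nonneg _) (pow_le_one₀ (norm_nonneg _) (hu k))
        have : 0 ≤ ∑' k, ‖a k‖ := tsum_nonneg fun k => norm_nonneg _
        gcongr
        exact ha.of_nonneg_of_le (fun k => by positivity) hle
        exact hle _
    _ = (2 * ∑' k, ‖a k‖) ^ 2 := by ring

/-! ### Distance from linear maps -/

/-- Orthogonality of random signs: for `i ≠ j`, flipping the `i`-th sign pairs off opposite terms.
-/
theorem sum_units_mul_eq_ite {n : ℕ} {R : Type*} [CommRing R] (i j : Fin n) :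
    ∑ ε : Fin n → ℤˣ, ((ε i : ℤ) : R) * ((ε j : ℤ) : R) =
      if i = j then (Fintype.card (Fin n → ℤˣ) : R) else 0 := by
  split_ifs with h
  · subst h
    have : ∀ ε : Fin n → ℤˣ, ((ε i : ℤ) : R) * ((ε i : ℤ) : R) = 1 := fun ε => by
      rw [← Int.cast_mul, ← Units.val_mul, Int.units_mul_self]
      simp
    simp [this]
  · have key : ∀ z : Fin n → ℤˣ, z i * z j = -(Function.update z i (-z i) i *
        Function.update z i (-z i) j) := by
      intro z
      simp [Function.update_of_ne (Ne.symm h)]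
    refine Finset.sum_involution (fun z _ => Function.update z i (-z i)) ?_ ?_ ?_ ?_
    · intro z _
      have := congrArg (fun t : ℤˣ => ((t : ℤ) : R)) (key z)
      push_cast at this
      rw [this]
      ring
    · intro z _ _ hz
      have := congrFun hz i
      simp only [Function.update_self] at this
      exact absurd this (by rcases Int.units_eq_one_or (z i) with h | h <;> rw [h] <;> decide)
    · intro z _
      exact Finset.mem_univ _
    · intro z _
      simp

/-- On `ℓ₂ⁿ` the Kalton–Peck map is far from every linear map. -/
theorem mul_log_le_of_norm_kaltonPeck_sub_le {𝕜 : Type*} [RCLike 𝕜] {n : ℕ} (hn : 0 < n)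
    (L : EuclideanSpace 𝕜 (Fin n) →ₗ[𝕜] EuclideanSpace 𝕜 (Fin n)) {c M : ℝ} (hc : 0 < c)
    (h : ∀ y, ‖y‖ ≤ 1 → ‖kaltonPeck ((c : 𝕜) • y) - L y‖ ≤ M) :
    c * Real.log n ≤ 4 * M := by
  have hn' : (0 : ℝ) < n := by exact_mod_cast hn
  set s : ℝ := (√n)⁻¹ with hs
  have hspos : 0 < s := by positivity
  have hs2 : s ^ 2 = (n : ℝ)⁻¹ := by rw [hs, inv_pow, Real.sq_sqrt hn'.le]
  let e : Fin n → EuclideanSpace 𝕜 (Fin n) := fun j => EuclideanSpace.single j 1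
  let τ : 𝕜 := ∑ i, L (e i) i
  -- the diagonal
  have hdiag : ‖((c * Real.log c : ℝ) : 𝕜) * n - τ‖ ≤ n * M := by
    have h1 : ((c * Real.log c : ℝ) : 𝕜) * n - τ =
        ∑ i, (kaltonPeck ((c : 𝕜) • e i) - L (e i)) i := by
      simp [τ, e, Finset.sum_sub_distrib, abs_of_pos hc]
      ring
    rw [h1]
    calc _ ≤ ∑ _i : Fin n, M := norm_sum_le_of_le _ fun i _ =>
          (PiLp.norm_apply_le _ i).trans (h _ (by simp [e]))
      _ = n * M := by simp
  -- the flat vectors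
  let x : (Fin n → ℤˣ) → EuclideanSpace 𝕜 (Fin n) := fun ε =>
    WithLp.toLp 2 fun i => (s : 𝕜) * ((ε i : ℤ) : 𝕜)
  have hxi : ∀ ε i, ‖x ε i‖ = s := by
    intro ε i
    rcases Int.units_eq_one_or (ε i) with h | h <;> simp [x, h, abs_of_pos hspos]
  have hx : ∀ ε, ‖x ε‖ = 1 := by
    intro ε
    rw [EuclideanSpace.norm_eq]
    simp [hxi, hs2, hn'.ne']
  have hconj : ∀ ε i, starRingEnd 𝕜 (x ε i) = x ε i := by
    intro ε i
    simp [x]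
  have hLx : ∀ ε i, L (x ε) i = ∑ j, x ε j * L (e j) i := by
    intro ε i
    have : x ε = ∑ j, x ε j • e j := by
      ext k
      simp [e, Pi.single_apply]
    conv_lhs => rw [this]
    simp
  have hterm : ∀ ε, ‖((c * Real.log (c * s) : ℝ) : 𝕜) - ∑ i, ∑ j, x ε i * x ε j * L (e j) i‖ ≤ M := by
    intro ε
    have h1 : inner 𝕜 (x ε) (kaltonPeck ((c : 𝕜) • x ε) - L (x ε)) =
        ((c * Real.log (c * s) : ℝ) : 𝕜) - ∑ i, ∑ j, x ε i * x ε j * L (e j) i := by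
      rw [inner_sub_right]
      congr 1
      · have h2 : kaltonPeck ((c : 𝕜) • x ε) = ((c * Real.log (c * s) : ℝ) : 𝕜) • x ε := by
          ext i
          rw [kaltonPeck_apply, PiLp.smul_apply, PiLp.smul_apply, smul_eq_mul, smul_eq_mul, norm_mul,
            RCLike.norm_ofReal, hxi, abs_of_pos hc]
          push_cast
          ring
        rw [h2, inner_smul_right, inner_self_eq_norm_sq_to_K, hx]
        simp
      · rw [PiLp.inner_apply]
        refine Finset.sum_congr rfl fun i _ => ?_
        rw [RCLike.inner_apply, hconj, hLx, Finset.sum_mul]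
        refine Finset.sum_congr rfl fun j _ => ?_
        ring
    rw [← h1]
    calc _ ≤ ‖x ε‖ * ‖kaltonPeck ((c : 𝕜) • x ε) - L (x ε)‖ := norm_inner_le_norm _ _
      _ ≤ M := by rw [hx, one_mul]; exact h _ (hx ε).le
  -- averaging over the signs
  set N : ℕ := Fintype.card (Fin n → ℤˣ) with hN
  have hNpos : (0 : ℝ) < N := by exact_mod_cast Fintype.card_pos
  -- Averaging `⟨x, L x⟩` over the signs leaves only the diagonal, that is `τ / n`.
  have hsum : ∑ ε, ∑ i, ∑ j, x ε i * x ε j * L (e j) i = (N : 𝕜) * ((n : 𝕜)⁻¹ * τ) := by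
    rw [Finset.sum_comm]
    simp_rw [Finset.sum_comm (s := (Finset.univ : Finset (Fin n → ℤˣ)))]
    have h1 : ∀ i j, ∑ ε, x ε i * x ε j * L (e j) i =
        (s : 𝕜) ^ 2 * (if i = j then (N : 𝕜) else 0) * L (e j) i := by
      intro i j
      rw [← Finset.sum_mul, ← sum_units_mul_eq_ite (R := 𝕜) i j, Finset.mul_sum]
      congr 1
      refine Finset.sum_congr rfl fun ε _ => ?_
      simp only [x]
      ring
    simp_rw [h1]
    have hs2' : (s : 𝕜) ^ 2 = (n : 𝕜)⁻¹ := by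
      rw [← RCLike.ofReal_pow, hs2]
      simp
    simp [hs2', τ, Finset.mul_sum]
    refine Finset.sum_congr rfl fun i _ => ?_
    ring
  have hflat : ‖((c * Real.log (c * s) : ℝ) : 𝕜) * n - τ‖ ≤ n * M := by
    have h1 : (N : 𝕜) * (((c * Real.log (c * s) : ℝ) : 𝕜) - (n : 𝕜)⁻¹ * τ) =
        ∑ ε, (((c * Real.log (c * s) : ℝ) : 𝕜) - ∑ i, ∑ j, x ε i * x ε j * L (e j) i) := by
      rw [Finset.sum_sub_distrib, hsum, Finset.sum_const, Finset.card_univ, ← hN, nsmul_eq_mul]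
      ring
    have h2 : (N : ℝ) * ‖((c * Real.log (c * s) : ℝ) : 𝕜) - (n : 𝕜)⁻¹ * τ‖ ≤ N * M := by
      calc _ = ‖(N : 𝕜) * (((c * Real.log (c * s) : ℝ) : 𝕜) - (n : 𝕜)⁻¹ * τ)‖ := by
            rw [norm_mul, RCLike.norm_natCast]
        _ ≤ ∑ _ε : Fin n → ℤˣ, M := by
            rw [h1]
            exact norm_sum_le_of_le _ fun ε _ => hterm ε
        _ = N * M := by simp [hN]
    have h3 := le_of_mul_le_mul_left h2 hNpos
    have hnk : (n : 𝕜) ≠ 0 := by exact_mod_cast hn.ne'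
    calc _ = ‖(n : 𝕜) * (((c * Real.log (c * s) : ℝ) : 𝕜) - (n : 𝕜)⁻¹ * τ)‖ := by
          congr 1
          field_simp
      _ = n * ‖((c * Real.log (c * s) : ℝ) : 𝕜) - (n : 𝕜)⁻¹ * τ‖ := by
          rw [norm_mul, RCLike.norm_natCast]
      _ ≤ n * M := by gcongr
  have hlog : Real.log (c * s) = Real.log c - Real.log n / 2 := by
    rw [Real.log_mul hc.ne' hspos.ne', hs, Real.log_inv, Real.log_sqrt hn'.le]
    ring
  have hfin : ‖((n * (c * Real.log n / 2) : ℝ) : 𝕜)‖ ≤ n * M + n * M := by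
    have h1 : ((n * (c * Real.log n / 2) : ℝ) : 𝕜) = (((c * Real.log c : ℝ) : 𝕜) * n - τ) -
        (((c * Real.log (c * s) : ℝ) : 𝕜) * n - τ) := by
      rw [hlog]
      push_cast
      ring
    rw [h1]
    exact (norm_sub_le _ _).trans (add_le_add hdiag hflat)
  rw [RCLike.norm_ofReal] at hfin
  have h1 := (le_abs_self _).trans hfin
  have h2 : (n : ℝ) * (c * Real.log n / 2) ≤ n * (2 * M) := by linarith
  linarith [le_of_mul_le_mul_left h2 hn']

/-! ### Consequences of the vanishing of `Ext¹` -/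

namespace BanachExt

/-- If `Ext¹(F, E) = 0`, then every exact sequence splits, whatever the universe of its
middle space. -/
theorem exists_retraction_of_forall_eq_zero {𝕜 : Type w} [RCLike 𝕜]
    {E : Type u} [NormedAddCommGroup E] [NormedSpace 𝕜 E] [CompleteSpace E]
    {F : Type v} [NormedAddCommGroup F] [NormedSpace 𝕜 F] [CompleteSpace F]
    (hzero : ∀ α : Ext1 𝕜 F E, α = 0)
    {G : Type*} [NormedAddCommGroup G] [NormedSpace 𝕜 G] [CompleteSpace G]
    (i : E →L[𝕜] G) (σ : G →L[𝕜] F) (hi : Function.Injective i) (hex : Function.Exact i σ)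
    (hσ : Function.Surjective σ) : ∃ r : G →L[𝕜] E, ∀ e, r (i e) = e := by
  -- A set-theoretic section of `σ` embeds `G` into `E × F`, so `G` has a copy in the universe
  -- required by `Extension`.
  have : Small.{max u v} G := by
    have hg : ∀ g : G, ∃ e, i e = g - Function.surjInv hσ (σ g) := fun g => by
      refine (hex _).1 ?_
      rw [map_sub, Function.surjInv_eq hσ, sub_self]
    choose ρ hρ using hg
    refine small_of_injective (β := E × F) (f := fun g => (ρ g, σ g)) fun g g' h => ?_
    simp only [Prod.mk.injEq] at h
    have := hρ g
    rw [h.1, h.2, hρ g'] at this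
    exact (sub_left_inj.1 this).symm
  let j : Shrink.{max u v} G ≃L[𝕜] G := Shrink.continuousLinearEquiv 𝕜 G
  have : CompleteSpace (Shrink.{max u v} G) :=
    (completeSpace_congr (e := j.toEquiv) j.isUniformEmbedding).2 inferInstance
  let X : Extension 𝕜 F E :=
    { G := Shrink.{max u v} G
      i := (j.symm : G →L[𝕜] Shrink.{max u v} G).comp i
      σ := σ.comp (j : Shrink.{max u v} G →L[𝕜] G)
      injective := j.symm.injective.comp hi
      exact := by
        intro g
        refine (hex (j g)).trans ⟨?_, ?_⟩
        · rintro ⟨e, he⟩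
          exact ⟨e, by simp [he]⟩
        · rintro ⟨e, rfl⟩
          exact ⟨e, by simp⟩
      surjective := hσ.comp j.surjective }
  obtain ⟨h, h1, -⟩ : Congruent 𝕜 F E X (trivialExtension 𝕜 F E) :=
    Quotient.exact (hzero (Ext1.mk 𝕜 F E X))
  refine ⟨(ContinuousLinearMap.fst 𝕜 E F).comp
    ((h : X.G →L[𝕜] E × F).comp (j.symm : G →L[𝕜] Shrink.{max u v} G)), fun e => ?_⟩
  exact congrArg Prod.fst (h1 e)

/-- If all operators into `E` extend from a subspace, then they do so with a uniform bound. -/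
theorem exists_norm_extension_le_of_forall_exists {𝕜 X E : Type*} [RCLike 𝕜]
    [NormedAddCommGroup X] [NormedSpace 𝕜 X]
    [NormedAddCommGroup E] [NormedSpace 𝕜 E] [CompleteSpace E] (K : Submodule 𝕜 X)
    (h : ∀ T : K →L[𝕜] E, ∃ S : X →L[𝕜] E, S.comp K.subtypeL = T) :
    ∃ M > 0, ∀ T : K →L[𝕜] E, ∃ S : X →L[𝕜] E, S.comp K.subtypeL = T ∧ ‖S‖ ≤ M * ‖T‖ := by
  let restrict : (X →L[𝕜] E) →L[𝕜] K →L[𝕜] E := K.subtypeL.precomp E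
  have hsurj : Function.Surjective restrict := h
  -- Open mapping theorem; both operator spaces are complete because `E` is.
  exact restrict.exists_preimage_norm_le hsurj

/-- If `Ext¹(F, E) = 0`, operators into `E` extend from the kernel of a quotient map onto `F`. -/
theorem exists_extension_of_forall_eq_zero {𝕜 : Type w} [RCLike 𝕜]
    {E : Type u} [NormedAddCommGroup E] [NormedSpace 𝕜 E] [CompleteSpace E]
    {F : Type v} [NormedAddCommGroup F] [NormedSpace 𝕜 F] [CompleteSpace F]
    (hzero : ∀ α : Ext1 𝕜 F E, α = 0)
    {X : Type*} [NormedAddCommGroup X] [NormedSpace 𝕜 X] [CompleteSpace X]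
    (q : X →L[𝕜] F) (hq : Function.Surjective q) (T : q.ker →L[𝕜] E) :
    ∃ S : X →L[𝕜] E, S.comp q.ker.subtypeL = T := by
  -- the pushout of `T` and the inclusion of the kernel
  let D : Submodule 𝕜 (E × X) :=
    (((-T).prod q.ker.subtypeL : q.ker →L[𝕜] E × X) : q.ker →ₗ[𝕜] E × X).range
  have hD : ∀ z : E × X, z ∈ D ↔ ∃ k : q.ker, -T k = z.1 ∧ (k : X) = z.2 := by
    intro z
    simp [D, LinearMap.mem_range, Prod.ext_iff]
  -- Closedness makes the pushout a Banach space; it follows from `ker q` being closed and `T`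
  -- continuous.
  have : IsClosed (D : Set (E × X)) := by
    have hker : IsClosed (q.ker : Set X) := q.isClosed_ker
    refine isClosed_of_closure_subset fun z hz => ?_
    obtain ⟨s, hs, hlim⟩ := mem_closure_iff_seq_limit.1 hz
    choose k hk1 hk2 using fun m => (hD (s m)).1 (hs m)
    have hl1 := (continuous_fst.tendsto z).comp hlim
    have hl2 := (continuous_snd.tendsto z).comp hlim
    have hz2 : z.2 ∈ q.ker := hker.mem_of_tendsto hl2
      (Filter.Eventually.of_forall fun m => by
        have := (k m).2
        rw [hk2] at this
        exact this)
    refine (hD z).2 ⟨⟨z.2, hz2⟩, ?_, rfl⟩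
    have hk : Filter.Tendsto k Filter.atTop (nhds ⟨z.2, hz2⟩) := by
      rw [tendsto_subtype_rng]
      simpa [Function.comp_def, hk2] using hl2
    have hT := ((-T).continuous.tendsto ⟨z.2, hz2⟩).comp hk
    refine tendsto_nhds_unique hT ?_
    simpa [Function.comp_def, hk1] using hl1
  let i : E →L[𝕜] (E × X) ⧸ D := D.mkQL.comp (ContinuousLinearMap.inl 𝕜 E X)
  let σ : (E × X) ⧸ D →L[𝕜] F := D.liftQL (q.comp (ContinuousLinearMap.snd 𝕜 E X)) (by
    intro z hz
    obtain ⟨k, -, hk⟩ := (hD z).1 hz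
    have := k.2
    rw [hk] at this
    exact this)
  have hσ : ∀ z : E × X, σ (D.mkQ z) = q z.2 := fun z => rfl
  obtain ⟨r, hr⟩ := exists_retraction_of_forall_eq_zero hzero i σ
    (by
      rw [injective_iff_map_eq_zero]
      intro e he
      obtain ⟨k, hk1, hk2⟩ := (hD (e, 0)).1 ((Submodule.Quotient.mk_eq_zero D).1 he)
      have : k = 0 := Subtype.ext hk2
      simpa [this] using hk1.symm)
    (by
      intro g
      obtain ⟨z, rfl⟩ := D.mkQ_surjective g
      rw [hσ]
      constructor
      · intro hz
        refine ⟨z.1 + T ⟨z.2, hz⟩, ?_⟩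
        refine (Submodule.Quotient.eq D).2 ((hD _).2 ⟨-⟨z.2, hz⟩, ?_, ?_⟩)
        · simp
        · simp
      · rintro ⟨e, he⟩
        rw [← hσ, ← he]
        exact map_zero q)
    (by
      intro f
      obtain ⟨x, rfl⟩ := hq f
      exact ⟨D.mkQ (0, x), rfl⟩)
  refine ⟨r.comp (D.mkQL.comp (ContinuousLinearMap.inr 𝕜 E X)), ?_⟩
  ext k
  have : D.mkQ (0, (k : X)) = i (T k) := by
    refine (Submodule.Quotient.eq D).2 ((hD _).2 ⟨k, ?_, ?_⟩)
    · simp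
    · simp
  rw [← hr (T k), ← this]
  rfl

/-- A uniformly complemented copy of `ℓ_p^n`, as a pair of operators with a uniform bound. -/
theorem ContainsUniformlyComplementedLp.exists_factorization {𝕜 : Type w} [RCLike 𝕜] {p : ℝ≥0∞}
    [Fact (1 ≤ p)] {E : Type u} [NormedAddCommGroup E] [NormedSpace 𝕜 E]
    (h : ContainsUniformlyComplementedLp 𝕜 p E) :
    ∃ C : ℝ, 0 ≤ C ∧ ∀ n : ℕ, ∃ (A : PiLp p (fun _ : Fin n => 𝕜) →L[𝕜] E)
      (B : E →L[𝕜] PiLp p (fun _ : Fin n => 𝕜)), (∀ y, B (A y) = y) ∧ ‖A‖ * ‖B‖ ≤ C := by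
  obtain ⟨C, hC⟩ := h
  refine ⟨(C + 1) * C, by positivity, fun n => ?_⟩
  obtain ⟨En, P, -, hP, hPC, hd⟩ := hC n
  -- The infimum need not be attained, hence `C + 1`.
  have hlt : banachMazurDist 𝕜 En (PiLp p (fun _ : Fin n => 𝕜)) < ((C + 1 : ℝ≥0) : ℝ≥0∞) :=
    hd.trans_lt (by exact_mod_cast lt_add_one C)
  obtain ⟨T, hT⟩ := iInf_lt_iff.1 hlt
  have hT' : ‖(T : En →L[𝕜] PiLp p (fun _ : Fin n => 𝕜))‖ *
      ‖(T.symm : PiLp p (fun _ : Fin n => 𝕜) →L[𝕜] En)‖ ≤ C + 1 := by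
    simp only [enorm_eq_nnnorm] at hT
    exact_mod_cast hT.le
  refine ⟨En.subtypeL.comp (T.symm : PiLp p (fun _ : Fin n => 𝕜) →L[𝕜] En),
    (T : En →L[𝕜] PiLp p (fun _ : Fin n => 𝕜)).comp P, fun y => ?_, ?_⟩
  · simp [hP]
  · have h1 : ‖En.subtypeL.comp (T.symm : PiLp p (fun _ : Fin n => 𝕜) →L[𝕜] En)‖ ≤
        ‖(T.symm : PiLp p (fun _ : Fin n => 𝕜) →L[𝕜] En)‖ :=
      ContinuousLinearMap.opNorm_le_bound _ (norm_nonneg _) fun y =>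
        (T.symm : PiLp p (fun _ : Fin n => 𝕜) →L[𝕜] En).le_opNorm y
    have h2 := (T : En →L[𝕜] PiLp p (fun _ : Fin n => 𝕜)).opNorm_comp_le P
    calc _ ≤ ‖(T.symm : PiLp p (fun _ : Fin n => 𝕜) →L[𝕜] En)‖ *
          (‖(T : En →L[𝕜] PiLp p (fun _ : Fin n => 𝕜))‖ * ‖P‖) := by gcongr
      _ = ‖(T : En →L[𝕜] PiLp p (fun _ : Fin n => 𝕜))‖ *
          ‖(T.symm : PiLp p (fun _ : Fin n => 𝕜) →L[𝕜] En)‖ * ‖P‖ := by ring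
      _ ≤ (C + 1) * C := by gcongr

end BanachExt

/-! ### The contradiction -/

theorem theorem8 {𝕜 : Type w} [RCLike 𝕜]
    (E : Type u) [NormedAddCommGroup E] [NormedSpace 𝕜 E] [CompleteSpace E]
    (F : Type v) [NormedAddCommGroup F] [NormedSpace 𝕜 F] [CompleteSpace F]
    (hE : ¬ FiniteDimensional 𝕜 E) (hF : ¬ FiniteDimensional 𝕜 F)
    (hE2 : BanachExt.ContainsUniformlyComplementedLp 𝕜 2 E)
    (hF2 : BanachExt.ContainsUniformlyComplementedLp 𝕜 2 F) :
    ∃ α : BanachExt.Ext1 𝕜 F E, α ≠ 0 := by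
  classical
  by_contra! hzero
  obtain ⟨CE, hCE, hfacE⟩ := hE2.exists_factorization
  obtain ⟨CF, hCF, hfacF⟩ := hF2.exists_factorization
  let I := Metric.closedBall (0 : F) 1
  have hI : ∀ k : I, ‖(k : F)‖ ≤ 1 := fun k => mem_closedBall_zero_iff.1 k.2
  let q : ℓ¹(I, 𝕜) →L[𝕜] F := lp.liftOne 𝕜 (fun k : I => (k : F)) 1 hI
  have hqs : ∀ k : I, q (lp.single 1 k 1) = k := lp.liftOne_single _ _ _
  have hq : Function.Surjective q := by
    intro f
    rcases eq_or_ne f 0 with rfl | hf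
    · exact ⟨0, map_zero q⟩
    · have hf' : ‖f‖ ≠ 0 := norm_ne_zero_iff.2 hf
      refine ⟨(‖f‖ : 𝕜) • lp.single 1 (⟨(‖f‖ : 𝕜)⁻¹ • f, ?_⟩ : I) 1, ?_⟩
      · rw [mem_closedBall_zero_iff, norm_smul]
        simp [hf']
      · rw [map_smul, hqs, smul_inv_smul₀ (by exact_mod_cast hf')]
  obtain ⟨M, hM, hext⟩ := BanachExt.exists_norm_extension_le_of_forall_exists q.ker
    (BanachExt.exists_extension_of_forall_eq_zero hzero q hq)
  -- The threshold is `4 * (2 * M * CE)`, with `2 * M * CE` bounding `‖R‖`, times the bound `CF` on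
  -- `a * b`.
  obtain ⟨n, hlog, hn⟩ := (((Real.tendsto_log_atTop.comp
    tendsto_natCast_atTop_atTop).eventually_gt_atTop (CF * (8 * M * CE))).and
    (Filter.eventually_gt_atTop (0 : ℕ))).exists
  obtain ⟨AE, BE, hE1, hEC⟩ := hfacE n
  obtain ⟨AF, BF, hF1, hFC⟩ := hfacF n
  have hAB : 0 < ‖AF‖ ∧ 0 < ‖BF‖ := by
    have hne : (EuclideanSpace.single (⟨0, hn⟩ : Fin n) (1 : 𝕜)) ≠ 0 := by
      simp
    constructor <;> refine norm_pos_iff.2 fun h => hne ?_ <;> rw [← hF1 (EuclideanSpace.single _ 1), h]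
      <;> simp
  set a := ‖AF‖
  set b := ‖BF‖
  obtain ⟨ha, hb⟩ := hAB
  let u : I → EuclideanSpace 𝕜 (Fin n) := fun k => (b⁻¹ : 𝕜) • BF k
  have hu : ∀ k, ‖u k‖ ≤ 1 := by
    intro k
    rw [norm_smul, norm_inv, RCLike.norm_ofReal, abs_of_pos hb, inv_mul_le_iff₀ hb]
    exact BF.le_opNorm_of_le (hI k)
  let S : ℓ¹(I, 𝕜) →L[𝕜] EuclideanSpace 𝕜 (Fin n) :=
    lp.liftOne 𝕜 (fun k => kaltonPeck (u k)) (√n) fun k => norm_kaltonPeck_le (hu k)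
  have hS : ∀ k : q.ker, ‖S k‖ ≤ 2 * ‖k‖ := by
    intro k
    refine norm_tsum_smul_kaltonPeck_le hu k ?_
    have h1 : (b⁻¹ : 𝕜) • BF (q k) = ∑' j, (k : ℓ¹(I, 𝕜)) j • u j := by
      rw [lp.liftOne_apply, ← smul_apply,
        ContinuousLinearMap.map_tsum _ (lp.summable_smul_of_bounded hI _)]
      simp [u]
    have hk : q k = 0 := k.2
    rw [← h1, hk]
    simp
  obtain ⟨T, hT, hTM⟩ := hext (AE.comp (S.comp q.ker.subtypeL))
  let R : ℓ¹(I, 𝕜) →L[𝕜] EuclideanSpace 𝕜 (Fin n) := BE.comp T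
  have hRS : ∀ k ∈ q.ker, R k = S k := by
    intro k hk
    have := DFunLike.congr_fun hT ⟨k, hk⟩
    change BE (T k) = S k
    rw [← hE1 (S k)]
    exact congrArg BE this
  have hR : ‖R‖ ≤ 2 * M * CE := by
    have h1 : ‖AE.comp (S.comp q.ker.subtypeL)‖ ≤ ‖AE‖ * 2 :=
      (AE.opNorm_comp_le _).trans (by
        gcongr
        exact ContinuousLinearMap.opNorm_le_bound _ zero_le_two hS)
    calc ‖R‖ ≤ ‖BE‖ * ‖T‖ := BE.opNorm_comp_le T
      _ ≤ ‖BE‖ * (M * (‖AE‖ * 2)) := by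
        gcongr
        exact hTM.trans (by gcongr)
      _ = 2 * M * (‖AE‖ * ‖BE‖) := by ring
      _ ≤ 2 * M * CE := by gcongr
  -- A merely algebraic section suffices, since the lower bound holds for discontinuous linear maps
  -- too.
  obtain ⟨g, hg⟩ := (q : ℓ¹(I, 𝕜) →ₗ[𝕜] F).exists_rightInverse_of_surjective
    (LinearMap.range_eq_top.2 hq)
  have hg' : ∀ x, q (g x) = x := fun x => LinearMap.congr_fun hg x
  let L : F →ₗ[𝕜] EuclideanSpace 𝕜 (Fin n) :=
    ((S - R : ℓ¹(I, 𝕜) →L[𝕜] EuclideanSpace 𝕜 (Fin n)) : ℓ¹(I, 𝕜) →ₗ[𝕜] _).comp g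
  have hL : ∀ x, L (q x) = S x - R x := by
    intro x
    have hk : g (q x) - x ∈ q.ker := by
      rw [LinearMap.mem_ker, map_sub]
      exact sub_eq_zero.2 (hg' _)
    have h1 := hRS _ hk
    rw [map_sub, map_sub] at h1
    change S (g (q x)) - R (g (q x)) = S x - R x
    rw [sub_eq_sub_iff_sub_eq_sub]
    exact h1.symm
  have hfar := mul_log_le_of_norm_kaltonPeck_sub_le hn
    ((a⁻¹ : 𝕜) • L.comp (AF : EuclideanSpace 𝕜 (Fin n) →ₗ[𝕜] F))
    -- `a⁻¹` brings `AF y` into the unit ball of `F`, and `b⁻¹` comes from the normalisation of `u`.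
    (c := (a * b)⁻¹) (M := 2 * M * CE) (by positivity) (by
      intro y hy
      let k : I := ⟨(a⁻¹ : 𝕜) • AF y, by
        rw [mem_closedBall_zero_iff, norm_smul, norm_inv, RCLike.norm_ofReal, abs_of_pos ha,
          inv_mul_le_iff₀ ha]
        exact AF.le_opNorm_of_le hy⟩
      have hk : u k = (((a * b)⁻¹ : ℝ) : 𝕜) • y := by
        simp only [u, k, map_smul, hF1, smul_smul]
        congr 1
        push_cast
        rw [mul_inv, mul_comm]
      have h1 : ((a⁻¹ : 𝕜) • L.comp (AF : EuclideanSpace 𝕜 (Fin n) →ₗ[𝕜] F)) y =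
          kaltonPeck (u k) - R (lp.single 1 k 1) := by
        have h2 : L (k : F) = ((a⁻¹ : 𝕜) • L.comp (AF : EuclideanSpace 𝕜 (Fin n) →ₗ[𝕜] F)) y :=
          map_smul L _ _
        rw [← h2, ← hqs k, hL]
        congr 1
        exact lp.liftOne_single _ _ _ k
      rw [h1, ← hk, sub_sub_cancel]
      refine (R.le_opNorm _).trans ?_
      rw [lp.norm_single one_pos, norm_one, mul_one]
      exact hR)
  rw [inv_mul_le_iff₀ (by positivity)] at hfar
  have : a * b * (4 * (2 * M * CE)) ≤ CF * (8 * M * CE) := by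
    calc _ = a * b * (8 * M * CE) := by ring
      _ ≤ _ := by gcongr
  exact absurd hlog (not_lt.2 (hfar.trans this))
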